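/- Let $\mathsf M=\langle S,\bar s,A,E,\Delta\rangle$ be a Markov decision process: $S$ and $A$ are finite sets of states and actions, $\bar s\in S$ is the initial state, $E(s)\subseteq A$ is the non-empty set of actions enabled in $s$, with $E(s)\cap E(s')=\emptyset$ for $s\neq s'$, and $\Delta(s,a)$ is a probability distribution on $S$ for every $s\in S$ and $a\in E(s)$. Let $0,1\in S$ be designated terminal states (a state $s$ is terminal if $\Delta(s,a)(s)=1$ for all $a\in E(s)$). An end component (EC) of $\mathsf M$ is a pair $(R,B)$ with $\emptyset\ne R\subseteq S$ and $B\subseteq\bigcup_{s\in R}E(s)$ such that (1) if $s\in R$, $a\in B\cap E(s)$ and $\Delta(s,a)(s')>0$, then $s'\in R$; and (2) for all $s,s'\in R$ there is a finite path $s_0a_0s_1\cdots s_n$ of $\mathsf M$ with $s_0=s$, $s_n=s'$ and $a_k\in B$ for all $0\le k<n$. Let $U:S\times A\to\mathbb R$. The Explore phase (for $U$) generates a path $s_0a_0s_1a_1\cdots$ as follows: $s_0=\bar s$, and for $k=1,2,\dots$ the $k$-th iteration picks $a_{k-1}$ uniformly at random among the actions maximising $U(s_{k-1},\cdot)$ over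 $E(s_{k-1})$, samples $s_k$ according to $\Delta(s_{k-1},a_{k-1})$, and appends $a_{k-1}s_k$ to the path. The phase terminates after iteration $k$ if $s_k\in\{0,1\}$. Let $K$, $E_m$ and $p_{\min}$ be real numbers with $K\ge|S|$, $E_m\ge\max_{s\in S}|E(s)|$ and $0<p_{\min}\le\Delta(s,a)(s')$ for all $s\in S$, $a\in E(s)$ and $s'$ with $\Delta(s,a)(s')>0$. Put $$\kappa=K\cdot E_m+1,\qquad c=\exp\left(-\frac{(p_{\min}/E_m)^{\kappa}}{\kappa}\right),$$ and let $i\ge\kappa$ be an integer. Assume that the Explore phase terminates with probability less than $1$. Then the probability that it does not terminate within $3i^3$ iterations is positive. Moreover, let $S_i$ and $A_i$ be the sets of the states $s$ and of the actions $a$, respectively, of those state–action pairs $(s,a)$ that occur more than $i$ times on the path explored in the first $3i^3$ iterations. Conditionally on the Explore phase not terminating within $3i^3$ iterations, the probability that $(S_i,A_i)$ is an end component of $\mathsf M$ is at least $$1-2c^i i^3\left(\frac{p_{\min}}{E_m}\right)^{-\kappa}.$$ -/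

import Mathlib

open MeasureTheory ProbabilityTheory

/-- A Markov decision process with states `S` and actions `A` (both assumed finite wherever the
structure is used). `trans s a` is only meaningful when `a` is enabled in `s`. As usual, every
action is enabled in at most one state. -/
structure MDP (S : Type*) (A : Type*) where
  /-- the initial state -/
  init : S
  /-- the enabled actions of a state -/
  enabled : S → Finset A
  enabled_nonempty : ∀ s, (enabled s).Nonempty
  enabled_disjoint : ∀ s t, s ≠ t → Disjoint (enabled s) (enabled t)
  /-- the probabilistic transition function -/
  trans : S → A → PMF S

namespace MDP

variable {S A : Type*}

/-- A state is terminal if every enabled action leads back to it with probability one. -/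
def IsTerminal (M : MDP S A) (s : S) : Prop :=
  ∀ a ∈ M.enabled s, M.trans s a s = 1

/-- One step of a path of the MDP that uses an action from `B`. -/
def StepIn (M : MDP S A) (B : Set A) (s t : S) : Prop :=
  ∃ a ∈ B, a ∈ M.enabled s ∧ 0 < M.trans s a t

/-- `(R, B)` is an end component: a nonempty set `R` of states and a set `B` of actions enabled in
states of `R` such that the actions of `B` never leave `R`, and any two states of `R` are connected
by a finite path all of whose actions lie in `B`. -/
structure IsEndComponent (M : MDP S A) (R : Set S) (B : Set A) : Prop where
  nonempty : R.Nonempty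
  enabled : ∀ a ∈ B, ∃ s ∈ R, a ∈ M.enabled s
  closed : ∀ s ∈ R, ∀ a ∈ B, a ∈ M.enabled s → ∀ t, 0 < M.trans s a t → t ∈ R
  connected : ∀ s ∈ R, ∀ t ∈ R, Relation.ReflTransGen (M.StepIn B) s t

open Classical in
/-- The enabled actions of `s` that maximise `U s`. -/
noncomputable def maxActions (M : MDP S A) (U : S → A → ℝ) (s : S) : Finset A :=
  (M.enabled s).filter fun a => ∀ b ∈ M.enabled s, U s b ≤ U s a

theorem maxActions_nonempty (M : MDP S A) (U : S → A → ℝ) (s : S) :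
    (M.maxActions U s).Nonempty := by
  classical
  obtain ⟨a, ha, hmax⟩ := (M.enabled s).exists_max_image (U s) (M.enabled_nonempty s)
  exact ⟨a, by simpa [maxActions] using ⟨ha, hmax⟩⟩

/-- The memoryless strategy that picks, uniformly at random, an enabled action maximising `U`. -/
noncomputable def greedy (M : MDP S A) (U : S → A → ℝ) (s : S) : PMF A :=
  PMF.uniformOfFinset (M.maxActions U s) (M.maxActions_nonempty U s)

/-- The law of the state-action pair `(s, a)` when the state `s` is given and the action `a` is
picked by the Explore phase. -/
noncomputable def choose (M : MDP S A) (U : S → A → ℝ) (s : S) : PMF (S × A) :=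
  (M.greedy U s).map fun a => (s, a)

/-- The law of the next state-action pair of the Explore phase after the pair `x`: the next state is
sampled according to the transition function, then an action is picked in that state. -/
noncomputable def exploreStep (M : MDP S A) (U : S → A → ℝ) (x : S × A) : PMF (S × A) :=
  (M.trans x.1 x.2).bind (M.choose U)

section Measure

variable [Countable S] [Countable A] [MeasurableSpace S] [MeasurableSpace A]
  [DiscreteMeasurableSpace S] [DiscreteMeasurableSpace A]

/-- The one-step kernel of the Explore phase, as a kernel from the past up to time `n`. -/
noncomputable def exploreKernel (M : MDP S A) (U : S → A → ℝ) (n : ℕ) :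
    Kernel (Finset.Iic n → S × A) (S × A) :=
  (Kernel.ofFunOfCountable fun x : S × A => (M.exploreStep U x).toMeasure).comap
    (fun h => h ⟨n, Finset.mem_Iic.2 le_rfl⟩) (measurable_pi_apply _)

instance instIsMarkovKernelExploreKernel (M : MDP S A) (U : S → A → ℝ) (n : ℕ) :
    IsMarkovKernel (M.exploreKernel U n) := by
  refine ⟨fun h => ?_⟩
  rw [exploreKernel, Kernel.comap_apply]
  exact PMF.toMeasure.isProbabilityMeasure (M.exploreStep U (h ⟨n, _⟩))

/-- The law of the infinite path `s₀ a₀ s₁ a₁ ⋯` (recorded as `n ↦ (sₙ, aₙ)`) sampled from the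
initial state when actions are picked uniformly among those maximising `U`. The Explore phase
follows this path until it terminates. -/
noncomputable def exploreMeasure (M : MDP S A) (U : S → A → ℝ) : Measure (ℕ → S × A) :=
  ((M.choose U M.init).toMeasure.map fun x (_ : Finset.Iic 0) => x).bind
    (Kernel.traj (X := fun _ => S × A) (M.exploreKernel U) 0)

end Measure

end MDP

/-- Iteration `k` of the Explore phase appends `aₖ₋₁ sₖ` to the path; the phase stops as soon as the
state just appended is one of the two designated states. -/
def terminatesWithin {S A : Type*} (zero one : S) (n : ℕ) : Set (ℕ → S × A) :=
  {ω | ∃ k, 1 ≤ k ∧ k ≤ n ∧ ((ω k).1 = zero ∨ (ω k).1 = one)}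

/-- The Explore phase terminates after some number of iterations. -/
def terminates {S A : Type*} (zero one : S) : Set (ℕ → S × A) :=
  {ω | ∃ k, 1 ≤ k ∧ ((ω k).1 = zero ∨ (ω k).1 = one)}

open Classical in
/-- The number of occurrences of the state-action pair `x` on the finite path
`s₀ a₀ s₁ ⋯ aₙ₋₁ sₙ` explored in the first `n` iterations. -/
noncomputable def occurrences {S A : Type*} (ω : ℕ → S × A) (n : ℕ) (x : S × A) : ℕ :=
  ((Finset.range n).filter fun k => ω k = x).card

/-- States of the pairs occurring more than `i` times on the path of the first `n` iterations. -/
def appStates {S A : Type*} (ω : ℕ → S × A) (n i : ℕ) : Set S :=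
  {s | ∃ a, i < occurrences ω n (s, a)}

/-- Actions of the pairs occurring more than `i` times on the path of the first `n` iterations. -/
def appActions {S A : Type*} (ω : ℕ → S × A) (n i : ℕ) : Set A :=
  {a | ∃ s, i < occurrences ω n (s, a)}

/-! The Explore phase is a finite Markov chain on state–action pairs. It stays in the set of enabled
pairs, whose size `m` is at most `κ - 1`, and each possible step has probability at least `q = pmin
/ Em`.

A pair is recurrent if it can be reached again from wherever it leads. The pairs reachable from a
recurrent pair form an end component (`isEndComponent_of_isRecurrent`), so it suffices that the
pairs seen more than `i` times are exactly such a class. Cut time into blocks of length `i`. A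
reachable target is reached within `m` steps with probability at least `q ^ m`, hence missed during
a whole block with probability at most `r = (1 - q ^ m) ^ (i / m)`. A union bound shows that,
outside probability `(1 + (i + 1) * m) * r`, the path becomes recurrent in the first block and then
visits its whole class in each of the next `i + 1` blocks. Pairs outside the class occur only in the
first block, so at most `i` times (`measure_not_recurrent_class_le`).

Conditioning costs at most a factor `(q ^ m)⁻¹`: if termination is not almost sure, some possible
path leads to a pair that cannot reach termination, and following it has probability at least `q ^
m` (`pow_le_measure_avoid`). `block_bound_le` turns the bounds into the stated constants. -/

open scoped ENNReal

/-! ### The Explore phase as a Markov chain on pairs -/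

/-- The law `P` of a path in `X` has the Markov property with one-step transition function `p`. -/
def IsMarkovLaw {X : Type*} [MeasurableSpace X] (p : X → PMF X) (P : Measure (ℕ → X)) : Prop :=
  ∀ (n : ℕ) (F : Set (ℕ → X)) (x y : X), DependsOn (· ∈ F) (Set.Iic n) → (∀ ω ∈ F, ω n = x) →
    P (F ∩ {ω | ω (n + 1) = y}) = P F * p x y

theorem exists_preimage_frestrictLe_eq {X : Type*} [Nonempty X] {n : ℕ} {F : Set (ℕ → X)}
    (hF : DependsOn (· ∈ F) (Set.Iic n)) :
    ∃ G : Set (Finset.Iic n → X), Preorder.frestrictLe (π := fun _ => X) n ⁻¹' G = F := by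
  refine ⟨Preorder.frestrictLe (π := fun _ => X) n '' F, ?_⟩
  refine Set.Subset.antisymm ?_ (Set.subset_preimage_image _ _)
  rintro ω ⟨ω', hω', h⟩
  have := hF (x := ω') (y := ω) fun j hj =>
    congrFun h ⟨j, Finset.mem_Iic.2 hj⟩
  exact this.mp hω'

theorem measurableSet_of_dependsOn {X : Type*} [Nonempty X] [Finite X] [MeasurableSpace X]
    [DiscreteMeasurableSpace X] {n : ℕ} {F : Set (ℕ → X)}
    (hF : DependsOn (· ∈ F) (Set.Iic n)) : MeasurableSet F := by
  obtain ⟨G, rfl⟩ := exists_preimage_frestrictLe_eq hF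
  exact Preorder.measurable_frestrictLe n (MeasurableSet.of_discrete)

namespace MDP

variable {S A : Type*} [Finite S] [Finite A] [MeasurableSpace S] [MeasurableSpace A]
  [DiscreteMeasurableSpace S] [DiscreteMeasurableSpace A]

theorem exploreMeasure_eq_trajMeasure (M : MDP S A) (U : S → A → ℝ) :
    M.exploreMeasure U = Kernel.trajMeasure (X := fun _ => S × A)
      (M.choose U M.init).toMeasure (M.exploreKernel U) := by
  rfl

instance (M : MDP S A) (U : S → A → ℝ) : IsProbabilityMeasure (M.exploreMeasure U) := by
  have := PMF.toMeasure.isProbabilityMeasure (M.choose U M.init)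
  rw [exploreMeasure_eq_trajMeasure]
  infer_instance

theorem isMarkovLaw_exploreMeasure (M : MDP S A) (U : S → A → ℝ) :
    IsMarkovLaw (M.exploreStep U) (M.exploreMeasure U) := by
  intro n F x y hF hx
  have := PMF.toMeasure.isProbabilityMeasure (M.choose U M.init)
  have : Nonempty (S × A) := ⟨x⟩
  obtain ⟨G, rfl⟩ := exists_preimage_frestrictLe_eq hF
  have key := Kernel.map_frestrictLe_trajMeasure_compProd_eq_map_trajMeasure
    (X := fun _ => S × A) (μ₀ := (M.choose U M.init).toMeasure) (κ := M.exploreKernel U) (a := n)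
  rw [← exploreMeasure_eq_trajMeasure] at key
  have h := congrArg (fun μ => μ (G ×ˢ {y})) key
  rw [Measure.map_apply (by fun_prop) (.prod .of_discrete .of_discrete),
    Measure.compProd_apply_prod .of_discrete .of_discrete] at h
  have e : (fun ω : ℕ → S × A => (Preorder.frestrictLe (π := fun _ => S × A) n ω, ω (n + 1))) ⁻¹'
      (G ×ˢ {y}) = Preorder.frestrictLe (π := fun _ => S × A) n ⁻¹' G ∩ {ω | ω (n + 1) = y} := by
    ext ω; simp
  rw [e] at h
  rw [← h]
  -- Every history in `G` ends in `x`, so the kernel is constant on `G` and the integral becomes a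
  -- product.
  have e2 : ∀ g ∈ G, M.exploreKernel U n g {y} = M.exploreStep U x y := by
    intro g hg
    obtain ⟨ω, rfl⟩ : ∃ ω, Preorder.frestrictLe (π := fun _ => S × A) n ω = g := by
      refine ⟨fun j => if hj : j ∈ Finset.Iic n then g ⟨j, hj⟩ else x, ?_⟩
      funext j
      simp [Finset.mem_Iic.1 j.2]
    rw [exploreKernel, Kernel.comap_apply, ← hx ω hg]
    exact PMF.toMeasure_apply_singleton _ _ .of_discrete
  rw [setLIntegral_congr_fun .of_discrete e2, setLIntegral_const,
    Measure.map_apply (by fun_prop) .of_discrete, mul_comm]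

theorem exploreMeasure_zero (M : MDP S A) (U : S → A → ℝ) (x : S × A) :
    M.exploreMeasure U {ω | ω 0 = x} = M.choose U M.init x := by
  have e : {ω : ℕ → S × A | ω 0 = x} = Preorder.frestrictLe (π := fun _ => S × A) 0 ⁻¹'
      {h | h ⟨0, by simp⟩ = x} := rfl
  rw [e, ← Measure.map_apply (by fun_prop) .of_discrete, exploreMeasure,
    Measure.map_comp _ _ (by fun_prop), Kernel.traj_map_frestrictLe, Kernel.partialTraj_self,
    Measure.id_comp, Measure.map_apply (Measurable.of_discrete) .of_discrete,
    ← PMF.toMeasure_apply_singleton _ _ .of_discrete]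
  rfl

end MDP

/-! ### Reachability and avoidance probabilities in finite chains -/

section Markov

variable {X : Type*} [Fintype X] {p : X → PMF X} {T : Set X} {q r : ℝ≥0∞}

/-- A set of states that the transition function `p` never leaves. -/
def ClosedUnder {X : Type*} (p : X → PMF X) (D : Set X) : Prop :=
  ∀ x ∈ D, ∀ y, p x y ≠ 0 → y ∈ D

/-- Reachability by finitely many transitions of positive probability. -/
abbrev Reaches {X : Type*} (p : X → PMF X) : X → X → Prop :=
  Relation.ReflTransGen fun x y => p x y ≠ 0

/-- The states from which `T` is reachable by exactly `k` transitions. -/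
def reachIn {X : Type*} (p : X → PMF X) (T : Set X) : ℕ → Set X
  | 0 => T
  | k + 1 => {x | ∃ y, p x y ≠ 0 ∧ y ∈ reachIn p T k}

theorem Reaches.exists_mem_reachIn {X : Type*} {p : X → PMF X} {T : Set X} {x y : X}
    (h : Reaches p x y) (hy : y ∈ T) : ∃ k, x ∈ reachIn p T k := by
  induction h using Relation.ReflTransGen.head_induction_on with
  | refl => exact ⟨0, hy⟩
  | head h _ ih =>
    obtain ⟨k, hk⟩ := ih
    exact ⟨k + 1, _, h, hk⟩

theorem ClosedUnder.of_reaches {X : Type*} {p : X → PMF X} {D : Set X} (hD : ClosedUnder p D)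
    {x y : X} (h : Reaches p x y) (hx : x ∈ D) : y ∈ D := by
  induction h with
  | refl => exact hx
  | tail _ h ih => exact hD _ ih _ h

theorem closedUnder_reaches {X : Type*} (p : X → PMF X) (x : X) :
    ClosedUnder p {y | Reaches p x y} :=
  fun _ h _ h' => Relation.ReflTransGen.tail h h'

/-- Along a shortest path to `T` all smaller distances to `T` occur. -/
theorem exists_mem_reachIn_minimal {X : Type*} {p : X → PMF X} {T D : Set X}
    (hD : ClosedUnder p D) {k : ℕ} :
    ∀ {x : X}, x ∈ D → x ∈ reachIn p T k → (∀ j < k, x ∉ reachIn p T j) →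
      ∀ l ≤ k, ∃ y ∈ D, y ∈ reachIn p T l ∧ ∀ j < l, y ∉ reachIn p T j := by
  induction k with
  | zero =>
    intro x hx h hmin l hl
    obtain rfl : l = 0 := by omega
    exact ⟨x, hx, h, hmin⟩
  | succ k ih =>
    intro x hx h hmin l hl
    obtain rfl | hl := Nat.eq_or_lt_of_le hl
    · exact ⟨x, hx, h, hmin⟩
    · obtain ⟨y, hxy, hy⟩ := h
      exact ih (hD x hx y hxy) hy
        (fun j hj hyj => hmin (j + 1) (by omega) ⟨y, hxy, hyj⟩) l (by omega)

/-- A shortest path of length `k` meets `k + 1` states of `D` at distances `0, …, k` from `T`; these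
are distinct, so `k + 1 ≤ D.card`. -/
theorem exists_lt_card_mem_reachIn {X : Type*} {p : X → PMF X} {T : Set X} {D : Finset X}
    (hD : ClosedUnder p D) {x : X} (hx : x ∈ D) (h : ∃ k, x ∈ reachIn p T k) :
    ∃ k < D.card, x ∈ reachIn p T k := by
  classical
  refine ⟨Nat.find h, ?_, Nat.find_spec h⟩
  have key := exists_mem_reachIn_minimal hD hx (Nat.find_spec h) fun j hj => Nat.find_min h hj
  have : Nonempty X := ⟨x⟩
  choose! f hfD hf hfmin using key
  have hinj : Set.InjOn f (Finset.range (Nat.find h + 1) : Set ℕ) := by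
    intro a ha b hb hab
    have ha' : a ≤ Nat.find h := by simpa [Nat.lt_succ_iff] using ha
    have hb' : b ≤ Nat.find h := by simpa [Nat.lt_succ_iff] using hb
    by_contra hne
    rcases Nat.lt_or_gt_of_ne hne with hlt | hlt
    · exact hfmin b hb' a hlt (hab ▸ hf a ha')
    · exact hfmin a ha' b hlt (hab ▸ hf b hb')
  have := Finset.card_le_card_of_injOn f
    (fun a ha => hfD a (by simpa [Nat.lt_succ_iff] using ha)) hinj
  simpa using this

/-- The probability of avoiding `T` at the times `0, …, k - 1` when starting from a given state. -/
noncomputable def avoidProb {X : Type*} [Fintype X] (p : X → PMF X) (T : Set X) : ℕ → X → ℝ≥0∞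
  | 0 => 1
  | k + 1 => Tᶜ.indicator fun x => ∑ y, p x y * avoidProb p T k y

theorem sum_pmf_coe (μ : PMF X) : ∑ y, μ y = 1 := by
  rw [← tsum_fintype (L := .unconditional _), μ.tsum_coe]

theorem avoidProb_succ_le (k : ℕ) (x : X) :
    avoidProb p T (k + 1) x ≤ ∑ y, p x y * avoidProb p T k y :=
  Set.indicator_le_self _ _ x

theorem avoidProb_succ_le_self (k : ℕ) (x : X) : avoidProb p T (k + 1) x ≤ avoidProb p T k x := by
  induction k generalizing x with
  | zero =>
    refine (avoidProb_succ_le 0 x).trans ?_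
    simp [avoidProb, sum_pmf_coe]
  | succ k ih =>
    refine Set.indicator_le_indicator ?_
    gcongr with y
    exact ih y

theorem avoidProb_antitone (x : X) : Antitone fun k => avoidProb p T k x :=
  antitone_nat_of_succ_le fun k => avoidProb_succ_le_self k x

theorem avoidProb_le_one (k : ℕ) (x : X) : avoidProb p T k x ≤ 1 :=
  avoidProb_antitone x (Nat.zero_le k)

/-- One particular path of length `k` into `T` already has probability at least `q ^ k`. The index
is `k + 1` because the arrival time `k` must be among the times watched. -/
theorem avoidProb_add_pow_le_one {D : Set X} (hD : ClosedUnder p D)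
    (hq : ∀ x ∈ D, ∀ y, p x y ≠ 0 → q ≤ p x y) (k : ℕ) :
    ∀ x ∈ D, x ∈ reachIn p T k → avoidProb p T (k + 1) x + q ^ k ≤ 1 := by
  classical
  induction k with
  | zero =>
    intro x _ hx
    have : avoidProb p T 1 x = 0 := Set.indicator_of_notMem (by simpa [reachIn] using hx) _
    simp [this]
  | succ k ih =>
    rintro x hx ⟨y, hxy, hy⟩
    calc avoidProb p T (k + 1 + 1) x + q ^ (k + 1)
        ≤ ∑ z, p x z * avoidProb p T (k + 1) z + p x y * q ^ k := by
          rw [pow_succ']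
          gcongr
          · exact avoidProb_succ_le _ _
          · exact hq x hx y hxy
      _ = ∑ z, p x z * (avoidProb p T (k + 1) z + if z = y then q ^ k else 0) := by
          simp [mul_add, Finset.sum_add_distrib]
      _ ≤ ∑ z, p x z * 1 := by
          gcongr with z
          split_ifs with h
          · subst h
            exact ih z (hD x hx z hxy) hy
          · simpa using avoidProb_le_one _ _
      _ = 1 := by simp [sum_pmf_coe]

/-- Markov property at time `a`: the chain is still in `D`, where the bound `r` is uniform. -/
theorem avoidProb_add_le {D : Set X} (hD : ClosedUnder p D) {b : ℕ}
    (h : ∀ x ∈ D, avoidProb p T b x ≤ r) (a : ℕ) :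
    ∀ x ∈ D, avoidProb p T (a + b) x ≤ avoidProb p T a x * r := by
  induction a with
  | zero => simpa [avoidProb] using h
  | succ a ih =>
    intro x hx
    rw [Nat.add_right_comm]
    by_cases hT : x ∈ T
    · have : avoidProb p T (a + b + 1) x = 0 := Set.indicator_of_notMem (by simpa using hT) _
      simp [this]
    · have h1 : avoidProb p T (a + 1) x = ∑ y, p x y * avoidProb p T a y :=
        Set.indicator_of_mem (by simpa using hT) _
      rw [h1, Finset.sum_mul]
      refine (avoidProb_succ_le _ _).trans (Finset.sum_le_sum fun y _ => ?_)
      by_cases hxy : p x y = 0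
      · simp [hxy]
      · rw [mul_assoc]
        gcongr
        exact ih y (hD x hx y hxy)

theorem avoidProb_mul_le {D : Set X} (hD : ClosedUnder p D) {m : ℕ}
    (h : ∀ x ∈ D, avoidProb p T m x ≤ r) (n : ℕ) :
    ∀ x ∈ D, avoidProb p T (m * n) x ≤ r ^ n := by
  induction n with
  | zero => simp [avoidProb]
  | succ n ih =>
    intro x hx
    rw [mul_add, mul_one, add_comm, pow_succ']
    exact (avoidProb_add_le hD ih m x hx).trans (by gcongr; exact h x hx)

/-- If `T` is reachable from every state of the closed set `D`, which has at most `m` elements, then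
the probability of avoiding `T` decays geometrically. -/
theorem avoidProb_le_pow {D : Finset X} (hD : ClosedUnder p D) {m : ℕ} (hm : D.card ≤ m)
    (hq1 : q ≤ 1) (hq : ∀ x ∈ D, ∀ y, p x y ≠ 0 → q ≤ p x y)
    (hT : ∀ x ∈ D, ∃ y ∈ T, Reaches p x y) (i : ℕ) :
    ∀ x ∈ D, avoidProb p T i x ≤ (1 - q ^ m) ^ (i / m) := by
  have key : ∀ x ∈ (D : Set X), avoidProb p T m x ≤ 1 - q ^ m := by
    intro x hx
    obtain ⟨y, hy, hxy⟩ := hT x hx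
    obtain ⟨k, hk, hkx⟩ := exists_lt_card_mem_reachIn hD hx (hxy.exists_mem_reachIn hy)
    have hle : k + 1 ≤ m := by omega
    refine ENNReal.le_sub_of_add_le_right ?_ ?_
    · exact ENNReal.pow_ne_top (ne_top_of_le_ne_top ENNReal.one_ne_top hq1)
    · refine (add_le_add (avoidProb_antitone x hle) ?_).trans
        (avoidProb_add_pow_le_one hD hq k x hx hkx)
      exact pow_le_pow_right_of_le_one' hq1 (by omega)
  intro x hx
  exact (avoidProb_antitone x (Nat.mul_div_le i m)).trans (avoidProb_mul_le hD key _ x hx)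

variable [MeasurableSpace X] {P : Measure (ℕ → X)}

/-- Transfers the recursive `avoidProb` to path space. The history `F` is arbitrary so that the
induction can absorb the next state into it. -/
theorem IsMarkovLaw.measure_inter_avoid_le (hP : IsMarkovLaw p P) (T : Set X) (k : ℕ) :
    ∀ (n : ℕ) (F : Set (ℕ → X)) (x : X), DependsOn (· ∈ F) (Set.Iic n) → (∀ ω ∈ F, ω n = x) →
      P (F ∩ {ω | ∀ j < k, ω (n + j) ∉ T}) ≤ P F * avoidProb p T k x := by
  induction k with
  | zero => intro n F x _ _; simp [avoidProb]
  | succ k ih =>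
    intro n F x hF hx
    by_cases hT : x ∈ T
    · have : F ∩ {ω | ∀ j < k + 1, ω (n + j) ∉ T} = ∅ := by
        ext ω
        simp only [Set.mem_inter_iff, Set.mem_ofPred_eq, Set.mem_empty_iff_false, iff_false, not_and]
        intro hω h
        exact h 0 (by omega) (by simpa [hx ω hω] using hT)
      rw [this, measure_empty]
      exact zero_le
    · have h1 : avoidProb p T (k + 1) x = ∑ y, p x y * avoidProb p T k y :=
        Set.indicator_of_mem (by simpa using hT) _
      have hsub : F ∩ {ω | ∀ j < k + 1, ω (n + j) ∉ T} ⊆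
          ⋃ y, (F ∩ {ω | ω (n + 1) = y}) ∩ {ω | ∀ j < k, ω (n + 1 + j) ∉ T} := by
        rintro ω ⟨hω, h⟩
        refine Set.mem_iUnion.2 ⟨ω (n + 1), ⟨hω, rfl⟩, fun j hj => ?_⟩
        rw [Nat.add_right_comm]
        exact h (j + 1) (by omega)
      refine (measure_mono hsub).trans ((measure_iUnion_fintype_le _ _).trans ?_)
      rw [h1, Finset.mul_sum]
      refine Finset.sum_le_sum fun y _ => ?_
      rw [← mul_assoc, ← hP n F x y hF hx]
      refine ih (n + 1) _ y ?_ (fun ω hω => hω.2)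
      intro ω ω' h
      have h2 := hF (x := ω) (y := ω') fun j hj => h j (by simp at hj ⊢; omega)
      have h3 := h (n + 1) (by simp)
      simp only [Set.mem_inter_iff, Set.mem_ofPred_eq, h3] at h2 ⊢
      rw [h2]

theorem dependsOn_eval_eq {X : Type*} (n : ℕ) (x : X) :
    DependsOn (· ∈ {ω : ℕ → X | ω n = x}) (Set.Iic n) := by
  intro ω ω' h
  simp [h n (by simp)]

theorem IsMarkovLaw.measure_mem_and_avoid_le [DiscreteMeasurableSpace X] [IsProbabilityMeasure P]
    (hP : IsMarkovLaw p P) {D : Set X} {k : ℕ} (h : ∀ x ∈ D, avoidProb p T k x ≤ r) (n : ℕ) :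
    P {ω | ω n ∈ D ∧ ∀ j < k, ω (n + j) ∉ T} ≤ r := by
  classical
  have hsub : {ω : ℕ → X | ω n ∈ D ∧ ∀ j < k, ω (n + j) ∉ T} ⊆
      ⋃ x : D, {ω | ω n = x} ∩ {ω | ∀ j < k, ω (n + j) ∉ T} :=
    fun ω hω => Set.mem_iUnion.2 ⟨⟨ω n, hω.1⟩, rfl, hω.2⟩
  have hdisj : ∑ x : D, P {ω : ℕ → X | ω n = x} ≤ 1 := by
    rw [← tsum_fintype (L := .unconditional _), ← measure_iUnion]
    · exact prob_le_one
    · intro x y hxy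
      refine Set.disjoint_left.2 fun ω h1 h2 => hxy (Subtype.ext (h1.symm.trans h2))
    · intro x
      exact (measurable_pi_apply (X := fun _ => X) n) (MeasurableSet.of_discrete (s := {x.1}))
  calc P {ω | ω n ∈ D ∧ ∀ j < k, ω (n + j) ∉ T}
      ≤ ∑ x : D, P ({ω | ω n = x} ∩ {ω | ∀ j < k, ω (n + j) ∉ T}) :=
        (measure_mono hsub).trans (measure_iUnion_fintype_le _ _)
    _ ≤ ∑ x : D, P {ω : ℕ → X | ω n = x} * r := by
        refine Finset.sum_le_sum fun x _ => ?_
        refine (hP.measure_inter_avoid_le T k n _ x (dependsOn_eval_eq n _) fun _ h => h).trans ?_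
        gcongr
        exact h x x.2
    _ ≤ r := by
        rw [← Finset.sum_mul]
        exact mul_le_of_le_one_left' hdisj

theorem IsMarkovLaw.ae_step (hP : IsMarkovLaw p P) :
    ∀ᵐ ω ∂P, ∀ n, p (ω n) (ω (n + 1)) ≠ 0 := by
  rw [ae_all_iff]
  intro n
  have : ∀ x y, p x y = 0 → ∀ᵐ ω ∂P, ¬ (ω n = x ∧ ω (n + 1) = y) := by
    intro x y hxy
    have := hP n {ω | ω n = x} x y (dependsOn_eval_eq n _) fun _ h => h
    rw [hxy, mul_zero] at this
    rw [ae_iff]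
    simpa [Set.ofPred_and] using this
  simp only [← ae_all_iff] at this
  have h2 : ∀ᵐ ω ∂P, ∀ x y, p x y = 0 → ¬ (ω n = x ∧ ω (n + 1) = y) := by
    simpa only [ae_all_iff] using this
  filter_upwards [h2] with ω hω h
  exact hω _ _ h ⟨rfl, rfl⟩

end Markov

/-! ### Recurrent classes and visit counts -/

section Recurrence

/-- A state that can be reached again from wherever the chain goes from it. -/
def IsRecurrent {X : Type*} (p : X → PMF X) (x : X) : Prop :=
  ∀ y, Reaches p x y → Reaches p y x

theorem IsRecurrent.of_reaches {X : Type*} {p : X → PMF X} {x y : X} (hx : IsRecurrent p x)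
    (h : Reaches p x y) : IsRecurrent p y :=
  fun z hz => (hx z (h.trans hz)).trans h

/-- Among the states reachable from `x`, one whose own reachable set is smallest is recurrent:
moving on cannot shrink that set. -/
theorem exists_isRecurrent_reaches {X : Type*} [Finite X] (p : X → PMF X) (x : X) :
    ∃ y, IsRecurrent p y ∧ Reaches p x y := by
  obtain ⟨y, hxy, hmin⟩ := Set.exists_min_image {y | Reaches p x y}
    (fun y => {z | Reaches p y z}.ncard) (Set.toFinite _) ⟨x, Relation.ReflTransGen.refl⟩
  refine ⟨y, fun z hz => ?_, hxy⟩
  have hsub : {w | Reaches p z w} ⊆ {w | Reaches p y w} := fun w hw => hz.trans hw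
  have := Set.eq_of_subset_of_ncard_le hsub (hmin z (Relation.ReflTransGen.trans hxy hz))
    (Set.toFinite _)
  have hy : y ∈ {w | Reaches p z w} := this ▸ Relation.ReflTransGen.refl
  exact hy

theorem reaches_of_step {X : Type*} {p : X → PMF X} {ω : ℕ → X}
    (hstep : ∀ n, p (ω n) (ω (n + 1)) ≠ 0) {a b : ℕ} (hab : a ≤ b) : Reaches p (ω a) (ω b) := by
  induction b, hab using Nat.le_induction with
  | base => exact Relation.ReflTransGen.refl
  | succ n _ ih => exact ih.tail (hstep n)

open Classical in
/-- A path that enters a recurrent class before time `i`, and that visits every state `y` of that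
class in each of `i + 1` consecutive blocks of length `i`, visits exactly the states of this class
more than `i` times. -/
theorem lt_card_visits_iff {X : Type*} {p : X → PMF X} {ω : ℕ → X}
    (hstep : ∀ n, p (ω n) (ω (n + 1)) ≠ 0) {i N k : ℕ} (hN : (i + 2) * i ≤ N)
    (hk : k < i)
    (hvisit : ∀ b < i + 1, ∀ y, Reaches p (ω k) y → ∃ j < i, ω ((b + 1) * i + j) = y) (y : X) :
    i < ((Finset.range N).filter fun n => ω n = y).card ↔ Reaches p (ω k) y := by
  constructor
  · intro h
    by_contra hy
    have hsub : ((Finset.range N).filter fun n => ω n = y) ⊆ Finset.range i := by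
      intro n hn
      obtain ⟨_, rfl⟩ := Finset.mem_filter.1 hn
      by_contra hni
      exact hy (reaches_of_step hstep (by simp at hni; omega))
    have := Finset.card_le_card hsub
    rw [Finset.card_range] at this
    omega
  · intro hy
    have hv : ∀ b < i + 1, ∃ j < i, ω ((b + 1) * i + j) = y := fun b hb => hvisit b hb y hy
    choose! f hf hfy using hv
    have : (Finset.range (i + 1)).card ≤ ((Finset.range N).filter fun n => ω n = y).card := by
      refine Finset.card_le_card_of_injOn (fun b => (b + 1) * i + f b) ?_ ?_
      · intro b hb
        have hb : b < i + 1 := by simpa using hb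
        simp only [Finset.coe_filter, Finset.mem_range, Set.mem_ofPred_eq]
        refine ⟨?_, hfy b hb⟩
        have := hf b hb
        have : (b + 1) * i ≤ (i + 1) * i := Nat.mul_le_mul_right _ hb
        nlinarith
      · intro b hb b' hb' h
        have hb : b < i + 1 := by simpa using hb
        have hb' : b' < i + 1 := by simpa using hb'
        -- Division by `i` recovers the block, so visits in different blocks are different times.
        have h' := congrArg (· / i) h
        simp only at h'
        rw [mul_comm, Nat.mul_add_div (by omega), Nat.div_eq_of_lt (hf b hb), mul_comm (b' + 1),
          Nat.mul_add_div (by omega), Nat.div_eq_of_lt (hf b' hb')] at h'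
        omega
    rw [Finset.card_range] at this
    omega

variable {X : Type*} [Fintype X] [MeasurableSpace X] [DiscreteMeasurableSpace X]
  {p : X → PMF X} {q : ℝ≥0∞} {P : Measure (ℕ → X)} [IsProbabilityMeasure P]

open Classical in
theorem IsMarkovLaw.measure_not_recurrent_class_le (hP : IsMarkovLaw p P) {E : Finset X}
    (hE : ClosedUnder p E) (h0 : ∀ᵐ ω ∂P, ω 0 ∈ E) {m : ℕ} (hm : E.card ≤ m) (hq1 : q ≤ 1)
    (hq : ∀ x ∈ E, ∀ y, p x y ≠ 0 → q ≤ p x y) {i N : ℕ} (hN : (i + 2) * i ≤ N) :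
    P {ω | ¬ ∃ z ∈ E, IsRecurrent p z ∧
        ∀ y, i < ((Finset.range N).filter fun n => ω n = y).card ↔ Reaches p z y} ≤
      (1 + (i + 1) * m) * (1 - q ^ m) ^ (i / m) := by
  set r : ℝ≥0∞ := (1 - q ^ m) ^ (i / m) with hr
  -- The bad events: `B₀` says that no recurrent state occurs in the first block, `B (b, y)` that
  -- block `b + 1` starts in the class of `y` and misses `y`.
  let B₀ : Set (ℕ → X) := {ω | ω 0 ∈ E ∧ ∀ j < i, ω (0 + j) ∉ {x | IsRecurrent p x}}
  let B : ℕ × X → Set (ℕ → X) := fun a =>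
    {ω | ω ((a.1 + 1) * i) ∈ {z | Reaches p a.2 z} ∧
      ∀ j < i, ω ((a.1 + 1) * i + j) ∉ ({a.2} : Set X)}
  let I : Finset (ℕ × X) := Finset.range (i + 1) ×ˢ E.filter (IsRecurrent p)
  have hB₀ : P B₀ ≤ r :=
    hP.measure_mem_and_avoid_le (D := E) (avoidProb_le_pow hE hm hq1 hq
      (fun x _ => exists_isRecurrent_reaches p x) i) 0
  have hB : ∀ a ∈ I, P (B a) ≤ r := by
    rintro ⟨b, y⟩ ha
    obtain ⟨hyE, hy⟩ := Finset.mem_filter.1 (Finset.mem_product.1 ha).2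
    let D : Finset X := Finset.univ.filter (Reaches p y)
    have hDcoe : (D : Set X) = {z | Reaches p y z} := by ext; simp [D]
    have hD : ClosedUnder p D := hDcoe ▸ closedUnder_reaches p y
    have hDE : D ⊆ E := fun z hz => hE.of_reaches (Finset.mem_filter.1 hz).2 hyE
    have := hP.measure_mem_and_avoid_le (D := D) (T := {y}) (avoidProb_le_pow hD
      ((Finset.card_le_card hDE).trans hm) hq1 (fun x hx => hq x (hDE hx))
      (fun x hx => ⟨y, Set.mem_singleton y, hy x (Finset.mem_filter.1 hx).2⟩) i) ((b + 1) * i)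
    rwa [hDcoe] at this
  have hsub : {ω | ¬ ∃ z ∈ E, IsRecurrent p z ∧
      ∀ y, i < ((Finset.range N).filter fun n => ω n = y).card ↔ Reaches p z y} ≤ᵐ[P]
      (B₀ ∪ ⋃ a ∈ I, B a : Set (ℕ → X)) := by
    filter_upwards [h0, hP.ae_step] with ω h0 hstep hω
    by_contra hbad
    have hbad : ω ∉ B₀ ∪ ⋃ a ∈ I, B a := hbad
    simp only [Set.mem_union, Set.mem_iUnion, not_or, not_exists] at hbad
    obtain ⟨hb0, hbB⟩ := hbad
    obtain ⟨k, hk, hrec⟩ : ∃ k < i, IsRecurrent p (ω k) := by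
      by_contra! hcon
      exact hb0 ⟨h0, fun j hj => by simpa using hcon j hj⟩
    have hkE : ω k ∈ E := hE.of_reaches (reaches_of_step hstep (Nat.zero_le k)) h0
    refine hω ⟨ω k, hkE, hrec, lt_card_visits_iff hstep hN hk fun b hb y hy => ?_⟩
    by_contra! hcon
    refine hbB (b, y) (Finset.mem_product.2 ⟨Finset.mem_range.2 hb,
      Finset.mem_filter.2 ⟨hE.of_reaches hy hkE, hrec.of_reaches hy⟩⟩) ⟨?_, ?_⟩
    -- Recurrence leads from `y` back to `ω k`, and the path leads on to the start of block `b + 1`.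
    · exact (hrec y hy).trans (reaches_of_step hstep (by nlinarith))
    · simpa using hcon
  calc _ ≤ P (B₀ ∪ ⋃ a ∈ I, B a) := measure_mono_ae hsub
    _ ≤ P B₀ + ∑ a ∈ I, P (B a) :=
        (measure_union_le _ _).trans (by gcongr; exact measure_biUnion_finset_le _ _)
    _ ≤ r + ∑ a ∈ I, r := by
        gcongr with a ha
        exact hB a ha
    _ ≤ (1 + (i + 1) * m) * r := by
        rw [Finset.sum_const, nsmul_eq_mul, add_mul, one_mul]
        gcongr
        have : I.card ≤ (i + 1) * m := by
          rw [Finset.card_product, Finset.card_range]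
          exact Nat.mul_le_mul_left _ ((Finset.card_filter_le _ _).trans hm)
        exact_mod_cast this

/-- If the absorbing set `T` is not hit almost surely at a positive time, then it is avoided forever
with a probability bounded away from zero. -/
theorem IsMarkovLaw.pow_le_measure_avoid (hP : IsMarkovLaw p P) {E : Finset X}
    (hE : ClosedUnder p E) {m : ℕ} (hm : E.card ≤ m) (hq0 : q ≠ 0) (hq1 : q ≤ 1)
    (hq : ∀ x ∈ E, ∀ y, p x y ≠ 0 → q ≤ p x y)
    (h0 : ∀ x, P {ω | ω 0 = x} ≠ 0 → x ∈ E ∧ q ≤ P {ω | ω 0 = x})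
    {T : Set X} (hT : ∀ x ∈ E, x ∈ T → ∀ y, p x y ≠ 0 → y ∈ T)
    (hhit : P {ω | ∃ k, 1 ≤ k ∧ ω k ∈ T} < 1) :
    q ^ m ≤ P {ω | ∀ k, 1 ≤ k → ω k ∉ T} := by
  classical
  have hET : ClosedUnder p (E ∩ T : Set X) :=
    fun x hx y hxy => ⟨hE x hx.1 y hxy, hT x hx.1 hx.2 y hxy⟩
  have hinit : ∀ᵐ ω ∂P, P {ω' | ω' 0 = ω 0} ≠ 0 := by
    have : ∀ᵐ ω ∂P, ∀ x, P {ω' | ω' 0 = x} = 0 → ω 0 ≠ x := by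
      rw [ae_all_iff]
      intro x
      by_cases h : P {ω' | ω' 0 = x} = 0
      · simp [ae_iff, h]
      · simp [h]
    filter_upwards [this] with ω hω h
    exact hω _ h rfl
  let W : Set X := {y | ∀ t, Reaches p y t → t ∉ T}
  -- Otherwise `T` is reachable from everything the chain can visit, hence hit almost surely,
  -- against `hhit`.
  obtain ⟨x₀, hx₀, y, hyW, hxy⟩ : ∃ x₀, P {ω | ω 0 = x₀} ≠ 0 ∧ ∃ y ∈ W, Reaches p x₀ y := by
    by_contra! hcon
    let D : Finset X := E.filter fun x => ∃ x₀, P {ω | ω 0 = x₀} ≠ 0 ∧ Reaches p x₀ x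
    have hDE : D ⊆ E := Finset.filter_subset _ _
    have hD : ClosedUnder p D := by
      intro x hx y hxy
      obtain ⟨hxE, x₀, hx₀, h⟩ := Finset.mem_filter.1 (Finset.mem_coe.1 hx)
      exact Finset.mem_coe.2 (Finset.mem_filter.2 ⟨hE x hxE y hxy, x₀, hx₀, h.tail hxy⟩)
    have hDT : ∀ x ∈ D, ∃ y ∈ T, Reaches p x y := by
      intro x hx
      obtain ⟨hxE, x₀, hx₀, h⟩ := Finset.mem_filter.1 hx
      by_contra! h'
      exact hcon x₀ hx₀ x (fun t ht htT => h' t htT ht) h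
    have hnull : P {ω | ω 0 ∈ (D : Set X) ∧ ∀ j, ω j ∉ T} = 0 := by
      obtain rfl | hm0 := Nat.eq_zero_or_pos m
      · have : D = ∅ := by
          rw [← Finset.card_eq_zero]
          exact Nat.le_zero.1 ((Finset.card_le_card hDE).trans hm)
        simp [this]
      have hlt : 1 - q ^ m < 1 :=
        ENNReal.sub_lt_self ENNReal.one_ne_top one_ne_zero (pow_ne_zero _ hq0)
      refine le_antisymm (ge_of_tendsto' (ENNReal.tendsto_pow_atTop_nhds_zero_of_lt_one hlt)
        fun n => ?_) zero_le
      have := hP.measure_mem_and_avoid_le (D := D) (T := T) (avoidProb_le_pow hD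
        ((Finset.card_le_card hDE).trans hm) hq1 (fun x hx => hq x (hDE hx)) hDT (m * n)) 0
      rw [Nat.mul_div_cancel_left _ hm0] at this
      refine (measure_mono ?_).trans this
      exact fun ω hω => ⟨hω.1, fun j _ => hω.2 _⟩
    have hae : (Set.univ : Set (ℕ → X)) ≤ᵐ[P] {ω | ∃ k, 1 ≤ k ∧ ω k ∈ T} := by
      filter_upwards [hinit, hP.ae_step, measure_eq_zero_iff_ae_notMem.1 hnull] with ω h1 hstep h2 _
      have hDω : ω 0 ∈ (D : Set X) :=
        Finset.mem_coe.2 (Finset.mem_filter.2 ⟨(h0 _ h1).1, _, h1, Relation.ReflTransGen.refl⟩)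
      obtain ⟨j, hj⟩ : ∃ j, ω j ∈ T := by
        by_contra! h
        exact h2 ⟨hDω, h⟩
      -- A hit at time `0` does not count, but `T` is absorbing, so time `j + 1` serves as well.
      exact ⟨j + 1, by omega, hT _ (hE.of_reaches (reaches_of_step hstep (Nat.zero_le j)) (h0 _ h1).1)
        hj _ (hstep j)⟩
    have := measure_mono_ae hae
    rw [measure_univ] at this
    exact absurd hhit (not_lt.2 this)
  obtain ⟨hx₀E, hqx₀⟩ := h0 x₀ hx₀
  obtain ⟨k, hk, hkx⟩ := exists_lt_card_mem_reachIn hE hx₀E (hxy.exists_mem_reachIn hyW)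
  set F : Set (ℕ → X) := {ω | ω 0 = x₀} with hF
  have h1 := avoidProb_add_pow_le_one (T := W) hE hq k x₀ hx₀E hkx
  have h2 := hP.measure_inter_avoid_le W (k + 1) 0 F x₀ (dependsOn_eval_eq 0 x₀) fun _ h => h
  have hfin : P F * avoidProb p W (k + 1) x₀ ≠ ⊤ :=
    ENNReal.mul_ne_top (measure_ne_top _ _) (ne_top_of_le_ne_top ENNReal.one_ne_top
      (avoidProb_le_one _ _))
  -- A path that visits `W` is never in `T`: not afterwards by definition of `W`, and not before
  -- because `T` is absorbing.
  have h3 : F ≤ᵐ[P] ({ω | ∀ k, 1 ≤ k → ω k ∉ T} ∪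
      (F ∩ {ω | ∀ j < k + 1, ω (0 + j) ∉ W}) : Set (ℕ → X)) := by
    filter_upwards [hP.ae_step] with ω hstep hω
    by_cases hav : ∀ j < k + 1, ω (0 + j) ∉ W
    · exact Or.inr ⟨hω, hav⟩
    left
    push Not at hav
    obtain ⟨j, -, hj⟩ := hav
    rw [zero_add] at hj
    intro n _ hn
    rcases le_total j n with hjn | hnj
    · exact hj _ (reaches_of_step hstep hjn) hn
    · have hnE : ω n ∈ (E : Set X) :=
        hE.of_reaches (reaches_of_step hstep (Nat.zero_le n)) (hω.symm ▸ hx₀E : ω 0 ∈ E)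
      exact hj _ Relation.ReflTransGen.refl
        (hET.of_reaches (reaches_of_step hstep hnj) ⟨hnE, hn⟩).2
  have h4 : P F * q ^ k + P F * avoidProb p W (k + 1) x₀ ≤
      P {ω | ∀ k, 1 ≤ k → ω k ∉ T} + P F * avoidProb p W (k + 1) x₀ :=
    calc _ = P F * (avoidProb p W (k + 1) x₀ + q ^ k) := by ring
      _ ≤ P F := mul_le_of_le_one_right' h1
      _ ≤ _ := (measure_mono_ae h3).trans (measure_union_le _ _)
      _ ≤ _ := by gcongr
  -- One factor `q` pays for starting at `x₀`, the other `k < m` for the steps into `W`.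
  calc q ^ m ≤ q ^ (k + 1) := pow_le_pow_right_of_le_one' hq1 (by omega)
    _ = q * q ^ k := pow_succ' _ _
    _ ≤ P F * q ^ k := by gcongr
    _ ≤ _ := (ENNReal.add_le_add_iff_right hfin).1 h4

end Recurrence

/-! ### The numerical estimate -/

theorem block_bound_le {q κ : ℝ} {i m : ℕ} (hq0 : 0 < q) (hq1 : q ≤ 1) (hm : 1 ≤ m)
    (hmκ : (m : ℝ) + 1 ≤ κ) (hκi : κ ≤ i) :
    (1 + ((i : ℝ) + 1) * m) * (1 - q ^ m) ^ (i / m) ≤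
      2 * Real.exp (-(q ^ κ / κ)) ^ i * (i : ℝ) ^ 3 := by
  have hm1 : (1 : ℝ) ≤ m := by exact_mod_cast hm
  have hκ0 : 0 < κ := by linarith
  set x := q ^ κ with hx
  have hx0 : 0 ≤ x := Real.rpow_nonneg hq0.le _
  have hx1 : x ≤ 1 := Real.rpow_le_one hq0.le hq1 hκ0.le
  have hxm : x ≤ q ^ m := by
    rw [hx, ← Real.rpow_natCast]
    exact Real.rpow_le_rpow_of_exponent_ge hq0 hq1 (by linarith)
  have hpow : q ^ m ≤ 1 := pow_le_one₀ hq0.le hq1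
  have hexp : 1 - q ^ m ≤ Real.exp (-x) := by
    have := Real.add_one_le_exp (-x)
    linarith
  -- Rounding `i / m` down loses less than one; this costs a factor `exp x ≤ exp 1 < 3` below.
  have hdiv : (i : ℝ) / κ ≤ ((i / m : ℕ) : ℝ) + 1 := by
    have h1 : (i : ℝ) ≤ m * (((i / m : ℕ) : ℝ) + 1) := by
      have := (Nat.lt_mul_div_succ i (show 0 < m by omega)).le
      exact_mod_cast this
    rw [div_le_iff₀ hκ0]
    have : (0 : ℝ) ≤ ((i / m : ℕ) : ℝ) + 1 := by positivity
    nlinarith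
  have hr : (1 - q ^ m) ^ (i / m) ≤ 3 * Real.exp (-(x / κ)) ^ i := by
    calc (1 - q ^ m) ^ (i / m) ≤ Real.exp (-x) ^ (i / m) := by
          gcongr
      _ = Real.exp (((i / m : ℕ) : ℝ) * -x) := (Real.exp_nat_mul _ _).symm
      _ ≤ Real.exp (1 + i * -(x / κ)) := by
          refine Real.exp_le_exp.2 ?_
          have h2 := mul_le_mul_of_nonneg_left hdiv hx0
          have h3 : (i : ℝ) * -(x / κ) = -(x * (i / κ)) := by ring
          rw [h3]
          linarith
      _ = Real.exp 1 * Real.exp (-(x / κ)) ^ i := by rw [Real.exp_add, Real.exp_nat_mul]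
      _ ≤ 3 * Real.exp (-(x / κ)) ^ i := by
          gcongr
          exact Real.exp_one_lt_three.le
  have hc : 0 ≤ Real.exp (-(x / κ)) ^ i := by positivity
  have hi : (m : ℝ) ≤ i - 1 := by linarith
  -- From `m ≤ i - 1`, since `1 + (i + 1) * (i - 1) = i ^ 2`. The remaining `3` is absorbed by `2 *
  -- i`, as `i ≥ 2`.
  have hcoef : 1 + ((i : ℝ) + 1) * m ≤ i ^ 2 := by nlinarith
  have hi2 : (2 : ℝ) ≤ i := by linarith
  calc _ ≤ (i : ℝ) ^ 2 * (3 * Real.exp (-(x / κ)) ^ i) := by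
        gcongr
    _ ≤ (i : ℝ) ^ 2 * ((2 * i) * Real.exp (-(x / κ)) ^ i) := by
        gcongr
        linarith
    _ = _ := by ring

/-! ### Transitions of the Explore phase and end components -/

namespace MDP

variable {S A : Type*}

theorem mem_maxActions {M : MDP S A} {U : S → A → ℝ} {s : S} {a : A}
    (h : a ∈ M.maxActions U s) : a ∈ M.enabled s := by
  classical
  unfold maxActions at h
  exact (Finset.mem_filter.1 h).1

theorem choose_apply (M : MDP S A) (U : S → A → ℝ) (s t : S) (b : A) [Decidable (s = t)] :
    M.choose U s (t, b) = if s = t then M.greedy U t b else 0 := by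
  classical
  rw [choose, PMF.map_apply]
  split_ifs with h
  · subst h
    rw [tsum_eq_single b]
    · simp
    · intro b' hb'
      simp [hb'.symm]
  · simp [Ne.symm h]

theorem exploreStep_apply (M : MDP S A) (U : S → A → ℝ) (x y : S × A) :
    M.exploreStep U x y = M.trans x.1 x.2 y.1 * M.greedy U y.1 y.2 := by
  classical
  obtain ⟨t, b⟩ := y
  rw [exploreStep, PMF.bind_apply, tsum_eq_single t]
  · simp [choose_apply]
  · intro t' ht'
    simp [choose_apply, ht']

theorem mem_maxActions_of_greedy_ne_zero {M : MDP S A} {U : S → A → ℝ} {s : S} {a : A}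
    (h : M.greedy U s a ≠ 0) : a ∈ M.maxActions U s := by
  rw [greedy, ← PMF.mem_support_iff] at h
  simpa using h

theorem le_greedy {M : MDP S A} {U : S → A → ℝ} {Em : ℝ}
    (hEm : ∀ s, ((M.enabled s).card : ℝ) ≤ Em) {s : S} {a : A} (h : M.greedy U s a ≠ 0) :
    ENNReal.ofReal Em⁻¹ ≤ M.greedy U s a := by
  have ha := mem_maxActions_of_greedy_ne_zero h
  have hpos : 0 < (M.enabled s).card := Finset.card_pos.2 (M.enabled_nonempty s)
  have hEm0 : 0 < Em := lt_of_lt_of_le (by exact_mod_cast hpos) (hEm s)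
  rw [greedy, PMF.uniformOfFinset_apply_of_mem _ ha, ENNReal.ofReal_inv_of_pos hEm0,
    ENNReal.inv_le_inv]
  have hle : (M.maxActions U s).card ≤ (M.enabled s).card :=
    Finset.card_le_card fun _ => mem_maxActions
  rw [← ENNReal.ofReal_natCast]
  exact ENNReal.ofReal_le_ofReal ((Nat.cast_le.2 hle).trans (hEm s))

theorem exploreStep_ne_zero_iff {M : MDP S A} {U : S → A → ℝ} {x y : S × A} :
    M.exploreStep U x y ≠ 0 ↔ 0 < M.trans x.1 x.2 y.1 ∧ y.2 ∈ M.maxActions U y.1 := by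
  rw [exploreStep_apply, mul_ne_zero_iff, pos_iff_ne_zero]
  refine and_congr_right fun _ => ⟨mem_maxActions_of_greedy_ne_zero, fun h => ?_⟩
  rw [greedy, ← PMF.mem_support_iff]
  simpa using h

theorem le_exploreStep {M : MDP S A} {U : S → A → ℝ} {Em pmin : ℝ}
    (hEm : ∀ s, ((M.enabled s).card : ℝ) ≤ Em) (hpmin : 0 < pmin)
    (hpmin_le : ∀ s, ∀ a ∈ M.enabled s, ∀ t ∈ (M.trans s a).support,
      pmin ≤ (M.trans s a t).toReal)
    {x y : S × A} (hx : x.2 ∈ M.enabled x.1) (h : M.exploreStep U x y ≠ 0) :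
    ENNReal.ofReal (pmin / Em) ≤ M.exploreStep U x y := by
  rw [exploreStep_apply] at h ⊢
  rw [div_eq_mul_inv, ENNReal.ofReal_mul hpmin.le]
  gcongr
  · exact ENNReal.ofReal_le_of_le_toReal
      (hpmin_le _ _ hx _ ((PMF.mem_support_iff _ _).2 (left_ne_zero_of_mul h)))
  · exact le_greedy hEm (right_ne_zero_of_mul h)

/-- The states and actions of a recurrent class of the Explore phase form an end component. -/
theorem isEndComponent_of_isRecurrent {M : MDP S A} {U : S → A → ℝ} {z : S × A}
    (hz : z.2 ∈ M.enabled z.1) (hrec : IsRecurrent (M.exploreStep U) z) :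
    M.IsEndComponent {s | ∃ a, Reaches (M.exploreStep U) z (s, a)}
      {a | ∃ s, Reaches (M.exploreStep U) z (s, a)} := by
  have hen : ∀ y, Reaches (M.exploreStep U) z y → y.2 ∈ M.enabled y.1 := by
    intro y hy
    induction hy with
    | refl => exact hz
    | tail _ h _ => exact mem_maxActions (exploreStep_ne_zero_iff.1 h).2
  refine ⟨⟨z.1, z.2, Relation.ReflTransGen.refl⟩, ?_, ?_, ?_⟩
  · rintro a ⟨s, hs⟩
    exact ⟨s, ⟨a, hs⟩, hen _ hs⟩
  · rintro s - a ⟨s', hs'⟩ ha t ht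
    -- Disjointness of the enabled sets: an action determines its state, so `B` records no less than
    -- the pairs do.
    obtain rfl : s' = s := by
      by_contra hne
      exact Finset.disjoint_left.1 (M.enabled_disjoint _ _ hne) (hen _ hs') ha
    obtain ⟨b, hb⟩ := M.maxActions_nonempty U t
    exact ⟨b, hs'.tail (exploreStep_ne_zero_iff.2 ⟨ht, hb⟩)⟩
  · rintro s ⟨a, hs⟩ t ⟨b, ht⟩
    have key : ∀ y, Reaches (M.exploreStep U) (s, a) y →
        Relation.ReflTransGen
          (M.StepIn {a | ∃ s, Reaches (M.exploreStep U) z (s, a)}) s y.1 := by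
      intro y hy
      induction hy with
      | refl => exact Relation.ReflTransGen.refl
      | @tail u v hu huv ih =>
        exact ih.tail ⟨u.2, ⟨u.1, hs.trans hu⟩, hen _ (hs.trans hu),
          (exploreStep_ne_zero_iff.1 huv).1⟩
    exact key (t, b) ((hrec _ hs).trans ht)

open Classical in
/-- The state-action pairs with an enabled action. -/
noncomputable def enabledPairs [Fintype S] [Fintype A] (M : MDP S A) : Finset (S × A) :=
  Finset.univ.filter fun x => x.2 ∈ M.enabled x.1

theorem mem_enabledPairs [Fintype S] [Fintype A] {M : MDP S A} {x : S × A} :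
    x ∈ M.enabledPairs ↔ x.2 ∈ M.enabled x.1 := by
  simp [enabledPairs]

theorem card_enabledPairs_le [Fintype S] [Fintype A] (M : MDP S A) {Em : ℝ}
    (hEm : ∀ s, ((M.enabled s).card : ℝ) ≤ Em) :
    (M.enabledPairs.card : ℝ) ≤ Fintype.card S * Em := by
  classical
  have hsub : M.enabledPairs ⊆
      Finset.univ.biUnion fun s => (M.enabled s).image (Prod.mk s) := by
    rintro ⟨s, a⟩ h
    simpa using mem_enabledPairs.1 h
  have h1 : M.enabledPairs.card ≤ ∑ s, (M.enabled s).card :=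
    (Finset.card_le_card hsub).trans (Finset.card_biUnion_le.trans
      (Finset.sum_le_sum fun s _ => Finset.card_image_le))
  calc (M.enabledPairs.card : ℝ) ≤ ∑ s, ((M.enabled s).card : ℝ) := by exact_mod_cast h1
    _ ≤ ∑ _s : S, Em := Finset.sum_le_sum fun s _ => hEm s
    _ = _ := by simp

theorem closedUnder_enabledPairs [Fintype S] [Fintype A] (M : MDP S A) (U : S → A → ℝ) :
    ClosedUnder (M.exploreStep U) (M.enabledPairs : Set (S × A)) :=
  fun _ _ _ hxy => Finset.mem_coe.2 (mem_enabledPairs.2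
    (mem_maxActions (exploreStep_ne_zero_iff.1 hxy).2))

theorem IsTerminal.eq_of_trans_pos {M : MDP S A} {s t : S} {a : A} (hs : M.IsTerminal s)
    (ha : a ∈ M.enabled s) (ht : 0 < M.trans s a t) : t = s := by
  have h1 := (PMF.apply_eq_one_iff _ _).1 (hs a ha)
  have h2 : t ∈ (M.trans s a).support := (PMF.mem_support_iff _ _).2 ht.ne'
  rw [h1] at h2
  exact h2

end MDP

/-! ### Conditioning and conclusion -/

theorem dependsOn_terminatesWithin_compl {S A : Type*} (zero one : S) (n : ℕ) :
    DependsOn (· ∈ (terminatesWithin (A := A) zero one n)ᶜ) (Set.Iic n) := by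
  intro ω ω' h
  have h' : ∀ k, 1 ≤ k → k ≤ n → ω k = ω' k := fun k _ hk => h k hk
  simp only [terminatesWithin, Set.mem_compl_iff, Set.mem_ofPred_eq, eq_iff_iff, not_iff_not]
  exact exists_congr fun k => and_congr_right fun h1 => and_congr_right fun h2 => by
    rw [h' k h1 h2]

theorem occurrences_eq_card {S A : Type*} (ω : ℕ → S × A) (n : ℕ) (x : S × A)
    [DecidablePred fun k => ω k = x] :
    occurrences ω n x = ((Finset.range n).filter fun k => ω k = x).card := by
  unfold occurrences
  congr!

/-- The conditional probability of `Gᶜ` is at most `P Gᶜ / P N`. Subadditivity replaces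
complementation, so `G` need not be measurable. -/
theorem one_sub_le_cond_real {Ω : Type*} [MeasurableSpace Ω] {P : Measure Ω}
    [IsProbabilityMeasure P] {N G : Set Ω} (hN : MeasurableSet N) {a b : ℝ} (ha : 0 < a)
    (haN : ENNReal.ofReal a ≤ P N) (hb : 0 ≤ b) (hG : P Gᶜ ≤ ENNReal.ofReal b) :
    1 - b * a⁻¹ ≤ (cond P N).real G := by
  have hN0 : P N ≠ 0 := ((ENNReal.ofReal_pos.2 ha).trans_le haN).ne'
  have := cond_isProbabilityMeasure hN0
  have h1 : 1 ≤ (cond P N).real G + (cond P N).real Gᶜ := by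
    have := measureReal_union_le (μ := cond P N) G Gᶜ
    simpa using this
  have h2 : (cond P N).real Gᶜ ≤ b * a⁻¹ := by
    refine ENNReal.toReal_le_of_le_ofReal (by positivity) ?_
    rw [cond_apply hN, mul_comm, ENNReal.ofReal_mul hb, ENNReal.ofReal_inv_of_pos ha]
    gcongr
    exact (measure_mono Set.inter_subset_right).trans hG
  linarith

theorem mainTheorem5 {S A : Type*} [Fintype S] [Fintype A]
    [MeasurableSpace S] [DiscreteMeasurableSpace S]
    [MeasurableSpace A] [DiscreteMeasurableSpace A]
    (M : MDP S A) (zero one : S) (hzero : M.IsTerminal zero) (hone : M.IsTerminal one)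
    (U : S → A → ℝ)
    (K Em pmin : ℝ) (hK : (Fintype.card S : ℝ) ≤ K)
    (hEm : ∀ s, ((M.enabled s).card : ℝ) ≤ Em)
    (hpmin : 0 < pmin)
    (hpmin_le : ∀ s, ∀ a ∈ M.enabled s, ∀ t ∈ (M.trans s a).support,
      pmin ≤ (M.trans s a t).toReal)
    (κ c : ℝ) (hκ : κ = K * Em + 1) (hc : c = Real.exp (-((pmin / Em) ^ κ / κ)))
    (i : ℕ) (hi : κ ≤ (i : ℝ))
    (hterm : M.exploreMeasure U (terminates zero one) < 1) :
    M.exploreMeasure U (terminatesWithin zero one (3 * i ^ 3))ᶜ ≠ 0 ∧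
      1 - 2 * c ^ i * (i : ℝ) ^ 3 * (pmin / Em) ^ (-κ) ≤
        (cond (M.exploreMeasure U) (terminatesWithin zero one (3 * i ^ 3))ᶜ).real
          {ω | M.IsEndComponent (appStates ω (3 * i ^ 3) i) (appActions ω (3 * i ^ 3) i)} := by
  classical
  obtain ⟨a₀, ha₀⟩ := M.enabled_nonempty M.init
  have hEm1 : 1 ≤ Em := by
    refine le_trans ?_ (hEm M.init)
    exact_mod_cast Finset.card_pos.2 ⟨a₀, ha₀⟩
  have hpmin1 : pmin ≤ 1 := by
    obtain ⟨t, ht⟩ := (M.trans M.init a₀).support_nonempty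
    exact (hpmin_le _ _ ha₀ t ht).trans
      (ENNReal.toReal_le_of_le_ofReal zero_le_one (by simpa using PMF.coe_le_one _ t))
  set q := pmin / Em with hq
  have hq0 : 0 < q := by positivity
  have hq1 : q ≤ 1 := (div_le_one (by linarith)).2 (by linarith)
  set m := M.enabledPairs.card with hm
  have hm1 : 1 ≤ m := Finset.card_pos.2 ⟨(M.init, a₀), MDP.mem_enabledPairs.2 ha₀⟩
  have hmκ : (m : ℝ) + 1 ≤ κ := by
    have h1 := M.card_enabledPairs_le hEm
    have h2 : (Fintype.card S : ℝ) * Em ≤ K * Em := by gcongr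
    linarith
  have hi2 : 2 ≤ i := by
    have : (1 : ℝ) ≤ m := by exact_mod_cast hm1
    have : (2 : ℝ) ≤ i := by linarith
    exact_mod_cast this
  have : Nonempty S := ⟨M.init⟩
  have : Nonempty A := ⟨a₀⟩
  have hP := M.isMarkovLaw_exploreMeasure U
  have hE := M.closedUnder_enabledPairs U
  have hqle : ∀ x ∈ M.enabledPairs, ∀ y, M.exploreStep U x y ≠ 0 →
      ENNReal.ofReal q ≤ M.exploreStep U x y :=
    fun x hx y h => MDP.le_exploreStep hEm hpmin hpmin_le (MDP.mem_enabledPairs.1 hx) h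
  have hqe1 : ENNReal.ofReal q ≤ 1 := ENNReal.ofReal_le_one.2 hq1
  have h0 : ∀ x, M.exploreMeasure U {ω | ω 0 = x} ≠ 0 →
      x ∈ M.enabledPairs ∧ ENNReal.ofReal q ≤ M.exploreMeasure U {ω | ω 0 = x} := by
    rintro ⟨s, a⟩ h
    rw [MDP.exploreMeasure_zero, MDP.choose_apply] at h ⊢
    split_ifs at h ⊢ with hs
    · refine ⟨MDP.mem_enabledPairs.2
        (MDP.mem_maxActions (MDP.mem_maxActions_of_greedy_ne_zero h)), ?_⟩
      refine le_trans (ENNReal.ofReal_le_ofReal ?_) (MDP.le_greedy hEm h)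
      rw [hq, div_eq_mul_inv]
      exact mul_le_of_le_one_left (by positivity) hpmin1
    · exact absurd rfl h
  have hinit : ∀ᵐ ω ∂M.exploreMeasure U, ω 0 ∈ M.enabledPairs := by
    have : ∀ᵐ ω ∂M.exploreMeasure U, ∀ x, x ∉ M.enabledPairs → ω 0 ≠ x := by
      rw [ae_all_iff]
      intro x
      by_cases hx : x ∈ M.enabledPairs
      · simp [hx]
      · have : M.exploreMeasure U {ω | ω 0 = x} = 0 := by
          by_contra h
          exact hx (h0 x h).1
        simpa [ae_iff, hx] using this
    filter_upwards [this] with ω hω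
    by_contra h
    exact hω _ h rfl
  have habs : ∀ x ∈ M.enabledPairs, x ∈ {x : S × A | x.1 = zero ∨ x.1 = one} →
      ∀ y, M.exploreStep U x y ≠ 0 → y ∈ {x : S × A | x.1 = zero ∨ x.1 = one} := by
    rintro ⟨s, a⟩ hx hxT y hxy
    have ha := MDP.mem_enabledPairs.1 hx
    have hpos := (MDP.exploreStep_ne_zero_iff.1 hxy).1
    rcases hxT with rfl | rfl
    · exact Or.inl (hzero.eq_of_trans_pos ha hpos)
    · exact Or.inr (hone.eq_of_trans_pos ha hpos)
  -- Never terminating is contained in not terminating within `3 * i ^ 3` iterations.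
  have hlow : ENNReal.ofReal (q ^ m) ≤
      M.exploreMeasure U (terminatesWithin zero one (3 * i ^ 3))ᶜ := by
    rw [ENNReal.ofReal_pow hq0.le]
    refine (hP.pow_le_measure_avoid hE le_rfl (ENNReal.ofReal_pos.2 hq0).ne' hqe1 hqle h0 habs
      hterm).trans (measure_mono ?_)
    rintro ω hω ⟨k, hk1, -, hk⟩
    exact hω k hk1 hk
  have hqm : 0 < q ^ m := pow_pos hq0 m
  have hN : (i + 2) * i ≤ 3 * i ^ 3 := by nlinarith [Nat.mul_le_mul hi2 hi2]
  have hbad := hP.measure_not_recurrent_class_le hE hinit le_rfl hqe1 hqle hN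
  have hbound : 0 ≤ (1 + ((i : ℝ) + 1) * m) * (1 - q ^ m) ^ (i / m) := by
    have : q ^ m ≤ 1 := pow_le_one₀ hq0.le hq1
    have : 0 ≤ 1 - q ^ m := by linarith
    positivity
  have hG : M.exploreMeasure U
      {ω | M.IsEndComponent (appStates ω (3 * i ^ 3) i) (appActions ω (3 * i ^ 3) i)}ᶜ ≤
      ENNReal.ofReal ((1 + ((i : ℝ) + 1) * m) * (1 - q ^ m) ^ (i / m)) := by
    have hsub : 0 ≤ 1 - q ^ m := sub_nonneg.2 (pow_le_one₀ hq0.le hq1)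
    -- The truncated subtraction in `ℝ≥0∞` agrees with the real one because `q ^ m ≤ 1`.
    have hconv : ENNReal.ofReal ((1 + ((i : ℝ) + 1) * m) * (1 - q ^ m) ^ (i / m)) =
        (1 + (i + 1) * m) * (1 - ENNReal.ofReal q ^ m) ^ (i / m) := by
      rw [ENNReal.ofReal_mul (by positivity), ENNReal.ofReal_pow hsub,
        ENNReal.ofReal_sub _ hqm.le, ENNReal.ofReal_pow hq0.le, ENNReal.ofReal_one]
      congr 1
      have : (1 + ((i : ℝ) + 1) * m) = ((1 + (i + 1) * m : ℕ) : ℝ) := by push_cast; ring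
      rw [this, ENNReal.ofReal_natCast]
      push_cast
      ring
    rw [hconv]
    refine (measure_mono ?_).trans hbad
    rintro ω hω ⟨z, hz, hrec, hiff⟩
    refine hω ?_
    have h1 : appStates ω (3 * i ^ 3) i = {s | ∃ a, Reaches (M.exploreStep U) z (s, a)} := by
      ext s
      refine exists_congr fun a => ?_
      have := hiff (s, a)
      rwa [← occurrences_eq_card] at this
    have h2 : appActions ω (3 * i ^ 3) i = {a | ∃ s, Reaches (M.exploreStep U) z (s, a)} := by
      ext a
      refine exists_congr fun s => ?_
      have := hiff (s, a)
      rwa [← occurrences_eq_card] at this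
    change M.IsEndComponent _ _
    rw [h1, h2]
    exact MDP.isEndComponent_of_isRecurrent (MDP.mem_enabledPairs.1 hz) hrec
  refine ⟨((ENNReal.ofReal_pos.2 hqm).trans_le hlow).ne', le_trans ?_ (one_sub_le_cond_real
    (measurableSet_of_dependsOn (dependsOn_terminatesWithin_compl zero one _)) hqm hlow hbound hG)⟩
  have hnum := block_bound_le (i := i) hq0 hq1 hm1 hmκ hi
  rw [hc]
  -- Uses `q ≤ 1` and `m ≤ κ`.
  have hinv : (q ^ m)⁻¹ ≤ q ^ (-κ) := by
    rw [Real.rpow_neg hq0.le, ← Real.rpow_natCast]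
    gcongr ?_⁻¹
    exact Real.rpow_le_rpow_of_exponent_ge hq0 hq1 (by linarith)
  refine sub_le_sub_left (mul_le_mul hnum hinv (by positivity) (by positivity)) 1
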